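/- A mixed hypergraph is a triple $H=(V,\mathcal C,\mathcal D)$ where $V$ is a finite set of vertices and $\mathcal C,\mathcal D$ are sets of subsets of $V$, called $C$-edges and $D$-edges. It is non-empty if $\mathcal C\cup\mathcal D\neq\emptyset$, and $(\ell,m)$-uniform if every $C$-edge has exactly $\ell$ elements and every $D$-edge has exactly $m$ elements. A coloring $c:V\to\mathbb N$ is proper if each $C$-edge contains two vertices of the same color and each $D$-edge contains two vertices of distinct colors; it is an $s$-coloring if it uses exactly $s$ colors. Two colorings are isomorphic if they are the same up to relabeling the colors; $r_s(H)$ is the number of proper $s$-colorings of $H$ up to isomorphism, and the feasible set of $H$ is $S(H)=\{s : H \text{ has a proper } s\text{-coloring}\}$. Write $[i,j]$ for the set of integers $k$ with $i\le k\le j$ (empty if $i>j$), and put $\min\emptyset=\infty$. Theorem. Let $\ell,m\ge 2$ be integers and let $S$ be a finite set of natural numbers. There is a non-empty $(\ell,m)$-uniform mixed hypergraph $H=(V,\mathcal C,\mathcal D)$ with $|V|\ge \ell-1$ and $S(H)=S$ if and only if (B1) $S=[1,x]$ for some $x\ge \ell-1$, or (B2) $\ell=2$ and $S$ is an interval of positive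 integers, i.e. $S=[a,b]$ for some $a\geq 1$ (the empty interval is allowed), or (B3) $\ell\ge 3$ and $\min S\ge \ell$ (this includes $S=\emptyset$), or (B4) $\ell\ge 3$, $\min S=a\in[2,\ell-1]$ and $[a,\ell-1]\subseteq S$. Moreover, if (B3) or (B4) holds and $r:S\to\mathbb N\setminus\{0\}$ is any function, then there is a non-empty $(\ell,m)$-uniform mixed hypergraph $H=(V,\mathcal C,\mathcal D)$ with $|V|\ge\ell-1$, $S(H)=S$ and $r_s(H)=r(s)$ for every $s\in S$ with $s\ge\ell$. -/

import Mathlib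

/-- A mixed hypergraph on the vertex set `V`: a set of `C`-edges and a set of `D`-edges, each edge
being a (finite) set of vertices. -/
structure MixedHypergraph (V : Type) where
  /-- the `C`-edges -/
  C : Set (Finset V)
  /-- the `D`-edges -/
  D : Set (Finset V)

namespace MixedHypergraph

variable {V : Type}

/-- Every `C`-edge has exactly `l` vertices and every `D`-edge has exactly `m` vertices. -/
def IsUniform (H : MixedHypergraph V) (l m : ℕ) : Prop :=
  (∀ e ∈ H.C, e.card = l) ∧ (∀ e ∈ H.D, e.card = m)

/-- The hypergraph has at least one edge. -/
def IsNonempty (H : MixedHypergraph V) : Prop :=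
  (H.C ∪ H.D).Nonempty

/-- A coloring is proper if every `C`-edge has two vertices of the same color and every `D`-edge
has two vertices of distinct colors. -/
def IsProper (H : MixedHypergraph V) (c : V → ℕ) : Prop :=
  (∀ e ∈ H.C, ∃ x ∈ e, ∃ y ∈ e, x ≠ y ∧ c x = c y) ∧
  (∀ e ∈ H.D, ∃ x ∈ e, ∃ y ∈ e, c x ≠ c y)

/-- A proper coloring that uses exactly `s` colors. -/
def IsProperColoring (H : MixedHypergraph V) (s : ℕ) (c : V → ℕ) : Prop :=
  H.IsProper c ∧ (Set.range c).Finite ∧ (Set.range c).ncard = s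

/-- The set of all `s` such that there is a proper `s`-coloring. -/
def feasibleSet (H : MixedHypergraph V) : Set ℕ :=
  {s | ∃ c : V → ℕ, H.IsProperColoring s c}

/-- Two proper `s`-colorings are isomorphic if they agree up to relabeling the colors. -/
def colorIso (H : MixedHypergraph V) (s : ℕ) :
    Setoid {c : V → ℕ // H.IsProperColoring s c} where
  r c c' := ∃ σ : Equiv.Perm ℕ, ∀ v, c'.1 v = σ (c.1 v)
  iseqv :=
    { refl := fun _ => ⟨Equiv.refl ℕ, fun _ => rfl⟩
      symm := fun ⟨σ, h⟩ => ⟨σ.symm, fun v => by rw [h v, Equiv.symm_apply_apply]⟩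
      trans := fun ⟨σ, h⟩ ⟨τ, k⟩ => ⟨σ.trans τ, fun v => by rw [k v, h v, Equiv.trans_apply]⟩ }

/-- The number `r_s(H)` of proper `s`-colorings up to isomorphism. (For finite `V` there are only
finitely many isomorphism classes.) -/
noncomputable def numColorings (H : MixedHypergraph V) (s : ℕ) : ℕ :=
  Nat.card (Quotient (H.colorIso s))

end MixedHypergraph

/-! Necessity is interpolation. Between a coloring and a refinement of it, every intermediate number
of colors occurs (`exists_coloring_between`), and refining never violates a `D`-edge. The `C`-edges
survive for one of three reasons: fewer than `l` colors force a repetition by pigeonhole; for `l =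
2` the common refinement of two proper colorings still satisfies them; if one color suffices, one
interpolates between a constant coloring and any proper one, whose repetitions persist under
coarsening.

For (B3) and (B4), take a product with `r s` coordinates of size `s` for each `s ∈ S`, times a set
`F` supplying copies of each point. The edges are all `l`-sets and `m`-sets compatible with every
coordinate read as a coloring. The point is that a proper coloring with at least `l` colors must be
a coordinate (`IsProper.exists_coordinate`): exchanging points in a rainbow `l`-tuple turns it into
a line in some direction `i`, every point then gets its color from its `i`-th coordinate, and
`D`-edges separate different values. Below `l` colors no classification is needed: a pigeonhole on a
diagonal gives at least `a` colors (`IsProper.le_ncard_range`), and all of `[a, l-1]` lies in `S`.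
Distinct coordinates give non-isomorphic colorings, hence the exact counts. -/

namespace MixedHypergraph

/-! ### Interpolation between colorings. -/

/-- Between a coloring and one refining it there are colorings with every intermediate number of
colors. -/
theorem exists_coloring_between {V : Type} [Finite V] {c c' : V → ℕ}
    (h : ∀ x y, c' x = c' y → c x = c y) {t : ℕ} (h₁ : (Set.range c).ncard ≤ t)
    (h₂ : t ≤ (Set.range c').ncard) :
    ∃ d : V → ℕ, (∀ x y, c' x = c' y → d x = d y) ∧ (∀ x y, d x = d y → c x = c y) ∧
      (Set.range d).ncard = t := by
  induction t, h₁ using Nat.le_induction with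
  | base => exact ⟨c, h, fun _ _ => id, rfl⟩
  | succ t _ ih =>
    obtain ⟨d, hd', hd, hdt⟩ := ih (by omega)
    obtain ⟨x, y, hxy, hne⟩ : ∃ x y, d x = d y ∧ c' x ≠ c' y := by
      by_contra! hcon
      have hle : (Set.range c').ncard ≤ (Set.range d).ncard := by
        have hsub : Set.range c' ⊆ (Function.extend d c' 0) '' Set.range d := by
          rintro _ ⟨v, rfl⟩
          refine ⟨d v, ⟨v, rfl⟩, ?_⟩
          exact Function.FactorsThrough.extend_apply (fun a b hab => hcon a b hab) _ _
        exact (Set.ncard_le_ncard hsub ((Set.finite_range d).image _)).trans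
          (Set.ncard_image_le (Set.finite_range d))
      omega
    obtain ⟨M, hM⟩ := (Set.finite_range d).exists_notMem
    -- Splitting the `c'`-class of `x` off its `d`-class adds exactly one color, since `y` keeps the
    -- old one.
    refine ⟨fun v => if c' v = c' x then M else d v, ?_, ?_, ?_⟩
    · intro u v huv
      simp only [huv, hd' u v huv]
    · intro u v huv
      dsimp only at huv
      split_ifs at huv with h1 h2 h2
      · exact h u v (h1.trans h2.symm)
      · exact absurd ⟨v, huv.symm⟩ hM
      · exact absurd ⟨u, huv⟩ hM
      · exact hd u v huv
    · have : Set.range (fun v => if c' v = c' x then M else d v) = insert M (Set.range d) := by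
        ext z
        simp only [Set.mem_range, Set.mem_insert_iff]
        constructor
        · rintro ⟨v, rfl⟩
          split_ifs
          · exact Or.inl rfl
          · exact Or.inr ⟨v, rfl⟩
        · rintro (rfl | ⟨v, rfl⟩)
          · exact ⟨x, by simp⟩
          · by_cases hv : c' v = c' x
            · refine ⟨y, ?_⟩
              rw [if_neg (Ne.symm hne), ← hxy, hd' v x hv]
            · exact ⟨v, by rw [if_neg hv]⟩
      rw [this, Set.ncard_insert_of_notMem hM (Set.finite_range d), hdt]

theorem ncard_range_of_injective {V : Type} [Finite V] {c : V → ℕ} (hc : Function.Injective c) :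
    (Set.range c).ncard = Nat.card V := by
  rw [← Set.image_univ, Set.ncard_image_of_injective _ hc, Set.ncard_univ]

theorem exists_injective_nat (V : Type) [Finite V] : ∃ c : V → ℕ, Function.Injective c := by
  obtain ⟨n, ⟨e⟩⟩ := Finite.exists_equiv_fin V
  exact ⟨fun v => (e v : ℕ), Fin.val_injective.comp e.injective⟩

theorem ncard_range_const {V : Type} [Nonempty V] (k : ℕ) :
    (Set.range (fun _ : V => k)).ncard = 1 := by
  simp

/-- A coloring with fewer than `e.card` colors repeats a color on `e`. -/
theorem exists_eq_of_ncard_lt {V : Type} {c : V → ℕ} (hfin : (Set.range c).Finite) {e : Finset V}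
    (h : (Set.range c).ncard < e.card) : ∃ x ∈ e, ∃ y ∈ e, x ≠ y ∧ c x = c y := by
  rw [Set.ncard_eq_toFinset_card _ hfin] at h
  exact Finset.exists_ne_map_eq_of_card_lt_of_maps_to h (fun x _ => by simp)

/-- A refinement of a proper coloring satisfies the `D`-edges. -/
theorem IsProper.of_between {V : Type} {H : MixedHypergraph V} {c d : V → ℕ} (hc : H.IsProper c)
    (hd : ∀ x y, d x = d y → c x = c y)
    (hC : ∀ e ∈ H.C, ∃ x ∈ e, ∃ y ∈ e, x ≠ y ∧ d x = d y) : H.IsProper d := by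
  refine ⟨hC, fun e he => ?_⟩
  obtain ⟨x, hx, y, hy, hxy⟩ := hc.2 e he
  exact ⟨x, hx, y, hy, fun h => hxy (hd x y h)⟩

/-! ### Necessary conditions on feasible sets. -/

theorem mem_feasibleSet_iff {V : Type} [Finite V] {H : MixedHypergraph V} {s : ℕ} :
    s ∈ H.feasibleSet ↔ ∃ c : V → ℕ, H.IsProper c ∧ (Set.range c).ncard = s :=
  ⟨fun ⟨c, h, _, h'⟩ => ⟨c, h, h'⟩, fun ⟨c, h, h'⟩ => ⟨c, h, Set.finite_range c, h'⟩⟩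

/-- With `C`-edges of size two, the feasible set is convex. -/
theorem mem_feasibleSet_of_two_uniform {V : Type} [Finite V] {H : MixedHypergraph V} {m : ℕ}
    (hU : H.IsUniform 2 m) {a b t : ℕ} (ha : a ∈ H.feasibleSet) (hb : b ∈ H.feasibleSet)
    (hat : a ≤ t) (htb : t ≤ b) : t ∈ H.feasibleSet := by
  rw [mem_feasibleSet_iff] at *
  obtain ⟨c, hc, rfl⟩ := ha
  obtain ⟨c', hc', rfl⟩ := hb
  have hpair : ∀ x y, Nat.pair (c x) (c' x) = Nat.pair (c y) (c' y) ↔ c x = c y ∧ c' x = c' y :=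
    fun x y => Nat.pair_eq_pair
  have hle : (Set.range c').ncard ≤ (Set.range fun v => Nat.pair (c v) (c' v)).ncard := by
    have : Set.range c' = (fun n => (Nat.unpair n).2) '' Set.range fun v => Nat.pair (c v) (c' v) := by
      rw [← Set.range_comp]
      congr 1
      ext v
      simp
    rw [this]
    exact Set.ncard_image_le (Set.finite_range _)
  -- Interpolate from `c` to the common refinement of `c` and `c'`, not to `c'`, which need not
  -- refine `c`. The two vertices of a `C`-edge agree under both colorings, hence under the pairing
  -- and under `d`.
  obtain ⟨d, hd', hd, hdt⟩ := exists_coloring_between (c := c)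
    (c' := fun v => Nat.pair (c v) (c' v)) (fun x y h => ((hpair x y).1 h).1) hat (htb.trans hle)
  refine ⟨d, hc.of_between hd fun e he => ?_, hdt⟩
  classical
  obtain ⟨x, y, hxy, rfl⟩ := Finset.card_eq_two.1 (hU.1 e he)
  obtain ⟨u, hu, v, hv, huv, h⟩ := hc.1 _ he
  obtain ⟨u', hu', v', hv', huv', h'⟩ := hc'.1 _ he
  simp only [Finset.mem_insert, Finset.mem_singleton] at hu hv hu' hv'
  refine ⟨x, by simp, y, by simp, hxy, hd' x y ((hpair x y).2 ?_)⟩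
  grind

/-- Colorings with fewer than `l` colors can be refined freely. -/
theorem mem_feasibleSet_of_lt {V : Type} [Finite V] {H : MixedHypergraph V} {l m : ℕ}
    (hU : H.IsUniform l m) {a t : ℕ} (ha : a ∈ H.feasibleSet) (hat : a ≤ t) (htl : t < l)
    (htV : t ≤ Nat.card V) : t ∈ H.feasibleSet := by
  rw [mem_feasibleSet_iff] at *
  obtain ⟨c, hc, rfl⟩ := ha
  obtain ⟨c', hc'⟩ := exists_injective_nat V
  -- The injective upper end need not be proper: `d` has fewer than `l` colors, so pigeonhole
  -- handles the `C`-edges.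
  obtain ⟨d, -, hd, hdt⟩ := exists_coloring_between (c := c) (c' := c')
    (fun x y h => congrArg c (hc' h)) hat (htV.trans (ncard_range_of_injective hc').ge)
  refine ⟨d, hc.of_between hd fun e he => ?_, hdt⟩
  exact exists_eq_of_ncard_lt (Set.finite_range d) (by rw [hdt, hU.1 e he]; exact htl)

/-- If a single color suffices, the feasible set is closed under decreasing. -/
theorem mem_feasibleSet_of_le {V : Type} [Finite V] [Nonempty V] {H : MixedHypergraph V}
    (h1 : 1 ∈ H.feasibleSet) {b t : ℕ} (hb : b ∈ H.feasibleSet) (ht : 1 ≤ t) (htb : t ≤ b) :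
    t ∈ H.feasibleSet := by
  rw [mem_feasibleSet_iff] at *
  obtain ⟨c, hc, hc1⟩ := h1
  obtain ⟨c', hc', rfl⟩ := hb
  obtain ⟨k, hk⟩ := Set.ncard_eq_one.1 hc1
  have hconst : ∀ v, c v = k := fun v => by
    have : c v ∈ Set.range c := ⟨v, rfl⟩
    rwa [hk] at this
  obtain ⟨d, hd', hd, hdt⟩ := exists_coloring_between (c := c) (c' := c')
    (fun x y _ => (hconst x).trans (hconst y).symm) (hc1.le.trans ht) htb
  refine ⟨d, hc.of_between hd fun e he => ?_, hdt⟩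
  obtain ⟨x, hx, y, hy, hxy, h⟩ := hc'.1 e he
  exact ⟨x, hx, y, hy, hxy, hd' x y h⟩

theorem feasibleSet_pos {V : Type} [Finite V] [Nonempty V] {H : MixedHypergraph V} {s : ℕ}
    (hs : s ∈ H.feasibleSet) : 1 ≤ s := by
  obtain ⟨c, -, rfl⟩ := mem_feasibleSet_iff.1 hs
  exact (Set.ncard_pos (Set.finite_range c)).2 (Set.range_nonempty c)

/-- The necessary conditions on a feasible set. -/
theorem feasibleSet_cases {V : Type} [Finite V] {H : MixedHypergraph V} {l m : ℕ} (hl : 2 ≤ l)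
    (hU : H.IsUniform l m) (hV : l - 1 ≤ Nat.card V) {S : Finset ℕ}
    (hS : H.feasibleSet = (S : Set ℕ)) :
    (∃ x : ℕ, l - 1 ≤ x ∧ S = Finset.Icc 1 x) ∨
    (l = 2 ∧ ∃ a b : ℕ, 1 ≤ a ∧ S = Finset.Icc a b) ∨
    (3 ≤ l ∧ ∀ s ∈ S, l ≤ s) ∨
    (3 ≤ l ∧ ∃ a : ℕ, IsLeast (S : Set ℕ) a ∧ 2 ≤ a ∧ a ≤ l - 1 ∧
      Finset.Icc a (l - 1) ⊆ S) := by
  have hmem : ∀ s, s ∈ S ↔ s ∈ H.feasibleSet := fun s => by rw [hS, Finset.mem_coe]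
  have : Nonempty V := (Nat.card_pos_iff.1 (by omega : 0 < Nat.card V)).1
  have hpos : ∀ s ∈ S, 1 ≤ s := fun s hs => feasibleSet_pos ((hmem s).1 hs)
  rcases S.eq_empty_or_nonempty with hne | hne
  · by_cases h2 : l = 2
    · exact Or.inr (Or.inl ⟨h2, 1, 0, le_rfl, by simpa using hne⟩)
    · exact Or.inr (Or.inr (Or.inl ⟨by omega, by simp [hne]⟩))
  have hmin := S.min'_mem hne
  have hmax := S.max'_mem hne
  by_cases h2 : l = 2
  · subst h2
    refine Or.inr (Or.inl ⟨rfl, S.min' hne, S.max' hne, hpos _ hmin, ?_⟩)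
    ext t
    rw [Finset.mem_Icc]
    refine ⟨fun h => ⟨S.min'_le t h, S.le_max' t h⟩, fun h => (hmem t).2 ?_⟩
    exact mem_feasibleSet_of_two_uniform hU ((hmem _).1 hmin) ((hmem _).1 hmax) h.1 h.2
  by_cases hB3 : ∀ s ∈ S, l ≤ s
  · exact Or.inr (Or.inr (Or.inl ⟨by omega, hB3⟩))
  have hal : S.min' hne ≤ l - 1 := by
    push Not at hB3
    obtain ⟨s, hs, hsl⟩ := hB3
    have := S.min'_le s hs
    omega
  have hIcc : ∀ t, S.min' hne ≤ t → t ≤ l - 1 → t ∈ S := fun t h h' =>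
    (hmem t).2 (mem_feasibleSet_of_lt hU ((hmem _).1 hmin) h (by omega) (by omega))
  by_cases ha : S.min' hne = 1
  · refine Or.inl ⟨S.max' hne, S.le_max' _ (hIcc _ hal le_rfl), ?_⟩
    ext t
    rw [Finset.mem_Icc]
    refine ⟨fun h => ⟨hpos t h, S.le_max' t h⟩, fun h => (hmem t).2 ?_⟩
    exact mem_feasibleSet_of_le ((hmem 1).1 (ha ▸ hmin)) ((hmem _).1 hmax) h.1 h.2
  · refine Or.inr (Or.inr (Or.inr ⟨by omega, S.min' hne, S.isLeast_min' hne, ?_, hal, ?_⟩))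
    · have := hpos _ hmin
      omega
    · intro t ht
      rw [Finset.mem_Icc] at ht
      exact hIcc t ht.1 ht.2

/-! ### Constructions for initial intervals and for `l = 2`. -/

/-- A single `C`-edge realizes an initial interval. -/
theorem exists_feasibleSet_eq_Icc_one {l : ℕ} (m x : ℕ) (hl : 2 ≤ l) (hx : l - 1 ≤ x) :
    ∃ (V : Type) (_ : Finite V) (H : MixedHypergraph V),
      H.IsNonempty ∧ H.IsUniform l m ∧ l - 1 ≤ Nat.card V ∧
        H.feasibleSet = (Finset.Icc 1 x : Finset ℕ) := by
  obtain ⟨e, -, he⟩ := Finset.exists_subset_card_eq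
    (s := (Finset.univ : Finset (Fin (x + 1)))) (n := l) (by rw [Finset.card_fin]; omega)
  -- On `x + 1` vertices the `C`-edge excludes the injective coloring, while merging two of its
  -- vertices leaves `x` colors.
  let H : MixedHypergraph (Fin (x + 1)) := ⟨{e}, ∅⟩
  refine ⟨Fin (x + 1), inferInstance, H, ⟨e, Or.inl rfl⟩, ⟨?_, ?_⟩, ?_, ?_⟩
  · intro e' (he' : e' = e)
    rw [he', he]
  · rintro _ ⟨⟩
  · simp
    omega
  have h1 : 1 ∈ H.feasibleSet := by
    refine mem_feasibleSet_iff.2 ⟨fun _ => 0, ⟨?_, by rintro _ ⟨⟩⟩, ncard_range_const 0⟩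
    intro e' (he' : e' = e)
    rw [he']
    obtain ⟨u, hu, v, hv, huv⟩ := Finset.one_lt_card.1 (by omega : 1 < e.card)
    exact ⟨u, hu, v, hv, huv, rfl⟩
  have hX : x ∈ H.feasibleSet := by
    obtain ⟨u, hu, v, hv, huv⟩ := Finset.one_lt_card.1 (by omega : 1 < e.card)
    refine mem_feasibleSet_iff.2 ⟨fun w => if w = u then v else w, ⟨?_, by rintro _ ⟨⟩⟩, ?_⟩
    · intro e' (he' : e' = e)
      rw [he']
      exact ⟨u, hu, v, hv, huv, by simp⟩
    · have : Set.range (fun w : Fin (x + 1) => ((if w = u then v else w : Fin (x + 1)) : ℕ)) =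
          Fin.val '' ({u}ᶜ : Set (Fin (x + 1))) := by
        ext z
        simp only [Set.mem_range, Set.mem_image, Set.mem_compl_iff, Set.mem_singleton_iff]
        constructor
        · rintro ⟨w, rfl⟩
          by_cases hw : w = u
          · exact ⟨v, huv.symm, by simp [hw]⟩
          · exact ⟨w, hw, by simp [hw]⟩
        · rintro ⟨w, hw, rfl⟩
          exact ⟨w, by simp [hw]⟩
      have hcast : (fun w : Fin (x + 1) => ((if w = u then (v : ℕ) else (w : ℕ)))) =
          fun w : Fin (x + 1) => ((if w = u then v else w : Fin (x + 1)) : ℕ) := by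
        ext w
        split_ifs <;> rfl
      rw [hcast, this, Set.ncard_image_of_injective _ Fin.val_injective, Set.ncard_compl]
      simp
  ext t
  simp only [Finset.coe_Icc, Set.mem_Icc]
  refine ⟨fun ht => ⟨feasibleSet_pos ht, ?_⟩, fun ht => mem_feasibleSet_of_le h1 hX ht.1 ht.2⟩
  obtain ⟨c, hc, rfl⟩ := mem_feasibleSet_iff.1 ht
  by_contra! hlt
  obtain ⟨u, -, v, -, huv, h⟩ := hc.1 e rfl
  have hinj : Set.InjOn c Set.univ := by
    refine Set.injOn_of_ncard_image_eq ?_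
    rw [Set.image_univ, Set.ncard_univ, Nat.card_fin]
    refine le_antisymm ?_ hlt
    have := Set.ncard_image_le (f := c) (s := Set.univ) Set.finite_univ
    rwa [Set.image_univ, Set.ncard_univ, Nat.card_fin] at this
  exact huv (hinj trivial trivial h)

/-- In a `(2, m)`-uniform hypergraph the empty feasible set is possible. -/
theorem exists_feasibleSet_eq_empty {m : ℕ} (hm : 2 ≤ m) :
    ∃ (V : Type) (_ : Finite V) (H : MixedHypergraph V),
      H.IsNonempty ∧ H.IsUniform 2 m ∧ 1 ≤ Nat.card V ∧ H.feasibleSet = ∅ := by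
  -- The pairs force a constant coloring, which the `D`-edge forbids.
  refine ⟨Fin m, inferInstance, ⟨{e | e.card = 2}, {Finset.univ}⟩, ⟨Finset.univ, Or.inr rfl⟩,
    ⟨fun e he => he, fun e he => ?_⟩, by simp; omega, ?_⟩
  · obtain rfl : e = Finset.univ := he
    simp
  rw [Set.eq_empty_iff_forall_notMem]
  rintro s ⟨c, hc, -⟩
  obtain ⟨x, -, y, -, hxy⟩ := hc.2 _ rfl
  have hne : x ≠ y := fun h => hxy (congrArg c h)
  obtain ⟨u, hu, v, hv, huv, h⟩ := hc.1 {x, y} (Finset.card_pair hne)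
  simp only [Finset.mem_insert, Finset.mem_singleton] at hu hv
  grind

/-- The set consisting of `(w, f)` for `f ∈ G` together with `q`. -/
theorem exists_finset_insert_fiber {W F : Type} {m : ℕ} (hm : 1 ≤ m) {w : W} {q : W × F}
    {G : Finset F} (hG : m - 1 ≤ G.card) (hq : ∀ f ∈ G, (w, f) ≠ q) :
    ∃ e : Finset (W × F), e.card = m ∧ q ∈ e ∧ (2 ≤ m → ∃ f, (w, f) ∈ e) ∧
      ∀ p ∈ e, p = q ∨ ∃ f ∈ G, p = (w, f) := by
  classical
  obtain ⟨G', hG', hcard⟩ := Finset.exists_subset_card_eq hG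
  refine ⟨insert q (G'.image fun f => (w, f)), ?_, by simp, fun h => ?_, ?_⟩
  · rw [Finset.card_insert_of_notMem, Finset.card_image_of_injective, hcard]
    · omega
    · exact fun f f' h => (Prod.mk.inj h).2
    · rw [Finset.mem_image]
      rintro ⟨f, hf, h⟩
      exact hq f (hG' hf) h
  · obtain ⟨f, hf⟩ := Finset.card_pos.1 (by omega : 0 < G'.card)
    exact ⟨f, by simp [hf]⟩
  · intro p hp
    rw [Finset.mem_insert, Finset.mem_image] at hp
    rcases hp with rfl | ⟨f, hf, rfl⟩
    · exact Or.inl rfl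
    · exact Or.inr ⟨f, hG' hf, rfl⟩

/-- Every interval is the feasible set of a `(2, m)`-uniform hypergraph. -/
theorem exists_feasibleSet_eq_Icc {m a b : ℕ} (hm : 2 ≤ m) (ha : 1 ≤ a) (hab : a ≤ b) :
    ∃ (V : Type) (_ : Finite V) (H : MixedHypergraph V),
      H.IsNonempty ∧ H.IsUniform 2 m ∧ 1 ≤ Nat.card V ∧
        H.feasibleSet = (Finset.Icc a b : Finset ℕ) := by
  -- The `C`-edges make each of the `b` fibers monochromatic, so at most `b` colors occur. The
  -- `D`-edges force different colors on the first `a` fibers. Fibers of size `m` leave room for `m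
  -- - 1` points in one fiber plus one in another.
  let H : MixedHypergraph (Fin b × Fin m) :=
    ⟨{e | e.card = 2 ∧ ∀ x ∈ e, ∀ y ∈ e, x.1 = y.1},
      {e | e.card = m ∧ (∃ x ∈ e, ∃ y ∈ e, x.1 ≠ y.1) ∧ ∀ x ∈ e, (x.1 : ℕ) < a}⟩
  have hb : 0 < b := by omega
  refine ⟨Fin b × Fin m, inferInstance, H, ?_, ⟨fun e he => he.1, fun e he => he.1⟩, ?_, ?_⟩
  · refine ⟨{(⟨0, hb⟩, ⟨0, by omega⟩), (⟨0, hb⟩, ⟨1, by omega⟩)}, Or.inl ⟨?_, ?_⟩⟩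
    · exact Finset.card_pair (by simp)
    · simp
  · rw [Nat.card_prod, Nat.card_fin, Nat.card_fin]
    exact Nat.mul_pos hb (by omega)
  have hfib : ∀ c, H.IsProper c → ∀ p q, p.1 = q.1 → c p = c q := by
    intro c hc p q hpq
    by_cases hne : p = q
    · rw [hne]
    obtain ⟨u, hu, v, hv, huv, h⟩ := hc.1 {p, q} ⟨Finset.card_pair hne, by
      intro x hx y hy
      simp only [Finset.mem_insert, Finset.mem_singleton] at hx hy
      grind⟩
    simp only [Finset.mem_insert, Finset.mem_singleton] at hu hv
    grind
  have hsep : ∀ c, H.IsProper c → ∀ p q, (p.1 : ℕ) < a → (q.1 : ℕ) < a → p.1 ≠ q.1 →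
      c p ≠ c q := by
    intro c hc p q hp hq hpq heq
    obtain ⟨e, hcard, hqe, hpe, he⟩ := exists_finset_insert_fiber (m := m) (by omega) (w := p.1)
      (q := q) (G := Finset.univ) (by simp)
      (fun f _ h => hpq (by rw [← h]))
    obtain ⟨f, hf⟩ := hpe hm
    have hce : ∀ x ∈ e, c x = c q := by
      intro x hx
      rcases he x hx with rfl | ⟨f', -, rfl⟩
      · rfl
      · rw [← heq]
        exact hfib c hc _ _ rfl
    obtain ⟨x, hx, y, hy, hxy⟩ := hc.2 e ⟨hcard, ⟨_, hf, q, hqe, hpq⟩, fun x hx => by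
      rcases he x hx with rfl | ⟨f', -, rfl⟩
      · exact hq
      · exact hp⟩
    exact hxy ((hce x hx).trans (hce y hy).symm)
  ext s
  rw [mem_feasibleSet_iff, Finset.coe_Icc, Set.mem_Icc]
  constructor
  · rintro ⟨c, hc, rfl⟩
    let o : Fin m := ⟨0, by omega⟩
    constructor
    · have hinj : Function.Injective fun i : Fin a => c (⟨i, by omega⟩, o) := by
        intro i j hij
        by_contra hne
        exact hsep c hc _ _ i.2 j.2 (fun h => hne (Fin.ext (Fin.mk.inj h))) hij
      rw [← Nat.card_fin a, ← ncard_range_of_injective hinj]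
      refine Set.ncard_le_ncard ?_ (Set.finite_range c)
      rintro _ ⟨i, rfl⟩
      exact ⟨_, rfl⟩
    · have : Set.range c ⊆ (fun i => c (i, o)) '' Set.univ := by
        rintro _ ⟨p, rfl⟩
        exact ⟨p.1, trivial, hfib c hc _ _ rfl⟩
      refine (Set.ncard_le_ncard this (Set.toFinite _)).trans ((Set.ncard_image_le).trans ?_)
      rw [Set.ncard_univ, Nat.card_fin]
  · rintro ⟨has, hsb⟩
    -- All fibers from index `s - 1` on are merged; as `a ≤ s`, the first `a` fibers stay distinct.
    refine ⟨fun p => min (p.1 : ℕ) (s - 1), ⟨?_, ?_⟩, ?_⟩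
    · rintro e ⟨hcard, he⟩
      obtain ⟨u, hu, v, hv, huv⟩ := Finset.one_lt_card.1 (by omega : 1 < e.card)
      exact ⟨u, hu, v, hv, huv, by simp only [he u hu v hv]⟩
    · rintro e ⟨-, ⟨x, hx, y, hy, hxy⟩, hlt⟩
      refine ⟨x, hx, y, hy, fun h => hxy (Fin.ext ?_)⟩
      have := hlt x hx
      have := hlt y hy
      dsimp only at h
      omega
    · have : Set.range (fun p : Fin b × Fin m => min (p.1 : ℕ) (s - 1)) = Set.Iio s := by
        ext z
        simp only [Set.mem_range, Set.mem_Iio]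
        constructor
        · rintro ⟨p, rfl⟩
          omega
        · intro hz
          exact ⟨(⟨z, by omega⟩, ⟨0, by omega⟩), by dsimp only; omega⟩
      rw [this, Set.ncard_eq_toFinset_card']
      simp

/-! ### The product hypergraph and its proper colorings. -/

section Product

variable {ι F : Type} {X : ι → Type}

/-- The hypergraph on `(Π j, X j) × F` whose `C`-edges are the `l`-sets on which no coordinate in
`A` is injective and whose `D`-edges are the `m`-sets on which no coordinate is constant. -/
def product (X : ι → Type) (F : Type) (A : Set ι) (l m : ℕ) :
    MixedHypergraph ((∀ j, X j) × F) where
  C := {e | e.card = l ∧ ∀ j ∈ A, ∃ x ∈ e, ∃ y ∈ e, x ≠ y ∧ x.1 j = y.1 j}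
  D := {e | e.card = m ∧ ∀ j, ∃ x ∈ e, ∃ y ∈ e, x.1 j ≠ y.1 j}

theorem product_isUniform (A : Set ι) (l m : ℕ) : (product X F A l m).IsUniform l m :=
  ⟨fun _ he => he.1, fun _ he => he.1⟩

/-- A coloring for which every rainbow `l`-tuple is injective in some coordinate of `A`. -/
def RainbowInjective (A : Set ι) (l : ℕ) (c : (∀ j, X j) × F → ℕ) : Prop :=
  ∀ p : Fin l → (∀ j, X j) × F, Function.Injective (c ∘ p) →
    ∃ j ∈ A, Function.Injective fun k => (p k).1 j

/-- Otherwise the points of the tuple would form a `C`-edge without a repeated color. The exchange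
arguments use `C`-edges only in this form. -/
theorem IsProper.rainbowInjective {A : Set ι} {l m : ℕ} {c : (∀ j, X j) × F → ℕ}
    (hc : (product X F A l m).IsProper c) : RainbowInjective A l c := by
  classical
  intro p hp
  by_contra! hcon
  have hpi : Function.Injective p := Function.Injective.of_comp hp
  obtain ⟨x, hx, y, hy, hxy, h⟩ := hc.1 (Finset.univ.image p)
    ⟨by rw [Finset.card_image_of_injective _ hpi, Finset.card_fin], fun j hj => by
      obtain ⟨k, k', hk, hne⟩ := Function.not_injective_iff.1 (hcon j hj)
      exact ⟨p k, by simp, p k', by simp, fun h => hne (hpi h), hk⟩⟩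
  simp only [Finset.mem_image, Finset.mem_univ, true_and] at hx hy
  obtain ⟨k, rfl⟩ := hx
  obtain ⟨k', rfl⟩ := hy
  exact hxy (congrArg p (hp h))

theorem injective_comp_update {V : Type} {l : ℕ} {c : V → ℕ} {p : Fin l → V}
    (hp : Function.Injective (c ∘ p)) {k : Fin l} {q : V} (hq : ∀ k', k' ≠ k → c q ≠ c (p k')) :
    Function.Injective (c ∘ Function.update p k q) := by
  intro u v huv
  simp only [Function.comp_apply, Function.update_apply] at huv
  split_ifs at huv with h1 h2 h2
  · exact h1.trans h2.symm
  · exact absurd huv (hq v h2)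
  · exact absurd huv.symm (hq u h1)
  · exact hp huv

/-- If `q` does not have one of the colors of `p k`, `k ∈ K`, then it can replace some `p k` with
`k ∉ K`. -/
theorem exists_injective_comp_update {V : Type} {l : ℕ} {c : V → ℕ} {p : Fin l → V}
    (hp : Function.Injective (c ∘ p)) {q : V} {K : Finset (Fin l)} (hK : K.card < l)
    (hq : ∀ k ∈ K, c q ≠ c (p k)) :
    ∃ k, k ∉ K ∧ Function.Injective (c ∘ Function.update p k q) := by
  by_cases h : ∃ k, c q = c (p k)
  · obtain ⟨k, hk⟩ := h
    refine ⟨k, fun hkK => hq k hkK hk, injective_comp_update hp fun k' hk' h => hk' ?_⟩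
    exact hp (h.symm.trans hk)
  · push Not at h
    obtain ⟨k, hk⟩ : ∃ k, k ∉ K := by
      by_contra! hcon
      rw [Finset.eq_univ_iff_forall.2 hcon, Finset.card_fin] at hK
      exact lt_irrefl _ hK
    exact ⟨k, hk, injective_comp_update hp fun k' _ => h k'⟩

/-- There is a rainbow tuple that is injective in a single coordinate of `A`. -/
theorem RainbowInjective.exists_unique [Finite ι] {A : Set ι} {l : ℕ} (hl : 3 ≤ l)
    {c : (∀ j, X j) × F → ℕ} (hc : RainbowInjective A l c) (p : Fin l → (∀ j, X j) × F)
    (hp : Function.Injective (c ∘ p)) :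
    ∃ p : Fin l → (∀ j, X j) × F, Function.Injective (c ∘ p) ∧
      ∃ i ∈ A, (Function.Injective fun k => (p k).1 i) ∧
        ∀ j ∈ A, (Function.Injective fun k => (p k).1 j) → j = i := by
  classical
  induction hn : {j ∈ A | Function.Injective fun k => (p k).1 j}.ncard using
    Nat.strong_induction_on generalizing p with
  | _ n ih =>
  obtain ⟨i, hiA, hi⟩ := hc p hp
  by_cases huniq : ∀ j ∈ A, (Function.Injective fun k => (p k).1 j) → j = i
  · exact ⟨p, hp, i, hiA, hi, huniq⟩
  push Not at huniq
  obtain ⟨i', hi'A, hi', hne⟩ := huniq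
  let I : Set ι := {j ∈ A | Function.Injective fun k => (p k).1 j}
  have hlt : ∀ p' : Fin l → (∀ j, X j) × F, Function.Injective (c ∘ p') → ∀ z ∈ I,
      (∀ j ∈ A, (Function.Injective fun k => (p' k).1 j) → j ∈ I ∧ j ≠ z) →
      ∃ p : Fin l → (∀ j, X j) × F, Function.Injective (c ∘ p) ∧
        ∃ i ∈ A, (Function.Injective fun k => (p k).1 i) ∧
          ∀ j ∈ A, (Function.Injective fun k => (p k).1 j) → j = i := by
    intro p' hp' z hz h
    refine ih _ ?_ p' hp' rfl
    rw [← hn]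
    refine Set.ncard_lt_ncard ⟨fun j hj => (h j hj.1 hj.2).1, fun hsub => ?_⟩ (Set.toFinite _)
    exact (h z (hsub hz).1 (hsub hz).2).2 rfl
  let k0 : Fin l := ⟨0, by omega⟩
  let k1 : Fin l := ⟨1, by omega⟩
  have h01 : k0 ≠ k1 := by simp [k0, k1]
  -- A hybrid of two points of the tuple. If it has the color of `p k1`, replacing `p k1` destroys
  -- injectivity outside `I \ {i}`; if it has the color of `p k0`, replacing `p k0` destroys it on
  -- `I \ {i}`, which contains `i'`. Either way the count drops.
  let q : (∀ j, X j) × F := (fun j => if j ∈ I ∧ j ≠ i then (p k1).1 j else (p k0).1 j, (p k0).2)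
  have hq1 : ∀ j, j ∈ I → j ≠ i → q.1 j = (p k1).1 j := fun j h h' => if_pos ⟨h, h'⟩
  have hq0 : ∀ j, ¬(j ∈ I ∧ j ≠ i) → q.1 j = (p k0).1 j := fun j h => if_neg h
  by_cases e1 : c q = c (p k1)
  · refine hlt (Function.update p k1 q) ?_ i ⟨hiA, hi⟩ ?_
    · refine injective_comp_update hp fun k hk h => hk (hp ?_)
      exact h.symm.trans e1
    · intro j hj hinj
      by_contra hcon
      refine h01 (hinj ?_)
      simp only [Function.update_self, Function.update_of_ne h01]
      exact (hq0 j hcon).symm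
  by_cases e0 : c q = c (p k0)
  · refine hlt (Function.update p k0 q) ?_ i' ⟨hi'A, hi'⟩ ?_
    · refine injective_comp_update hp fun k hk h => hk (hp ?_)
      exact h.symm.trans e0
    · intro j hj hinj
      by_cases hji : j ∈ I ∧ j ≠ i
      · refine absurd (hinj ?_) h01
        simp only [Function.update_self, Function.update_of_ne h01.symm]
        exact hq1 j hji.1 hji.2
      · have hjI : j ∈ I := by
          refine ⟨hj, ?_⟩
          convert hinj using 2 with k
          by_cases hk : k = k0
          · rw [hk, Function.update_self, hq0 j hji]
          · rw [Function.update_of_ne hk]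
        refine ⟨hjI, ?_⟩
        rintro rfl
        exact hji ⟨hjI, hne⟩
  -- Now `q` replaces a third point, possible as `l ≥ 3`; then every coordinate of `q` repeats that
  -- of `p k0` or `p k1`.
  · exfalso
    obtain ⟨k, hkK, hinj⟩ := exists_injective_comp_update hp (q := q) (K := {k0, k1})
      (by rw [Finset.card_pair h01]; omega) (by simp [e0, e1])
    simp only [Finset.mem_insert, Finset.mem_singleton, not_or] at hkK
    obtain ⟨j, -, hj⟩ := hc _ hinj
    by_cases hji : j ∈ I ∧ j ≠ i
    · refine hkK.2 (hj ?_)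
      simp only [Function.update_self, Function.update_of_ne (Ne.symm hkK.2)]
      exact hq1 j hji.1 hji.2
    · refine hkK.1 (hj ?_)
      simp only [Function.update_self, Function.update_of_ne (Ne.symm hkK.1)]
      exact hq0 j hji

/-- There is a rainbow tuple that is constant in all coordinates except one. -/
theorem RainbowInjective.exists_line [Finite ι] {A : Set ι} {l : ℕ} (hl : 3 ≤ l)
    {c : (∀ j, X j) × F → ℕ} (hc : RainbowInjective A l c) (p : Fin l → (∀ j, X j) × F)
    (hp : Function.Injective (c ∘ p)) :
    ∃ p : Fin l → (∀ j, X j) × F, Function.Injective (c ∘ p) ∧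
      ∃ i ∈ A, ∀ j, j ≠ i → ∀ k k', (p k).1 j = (p k').1 j := by
  classical
  obtain ⟨p, hp, i, hiA, hi, huniq⟩ := hc.exists_unique hl p hp
  let k0 : Fin l := ⟨0, by omega⟩
  -- Project the tuple to the line through `p k0` in direction `i`. Were `q k` colored differently
  -- from `p k`, it could replace another point of the tuple; that kills injectivity in `i` and
  -- creates it nowhere else.
  let q : Fin l → (∀ j, X j) × F := fun k => (Function.update (p k0).1 i ((p k).1 i), (p k0).2)
  have hqi : ∀ k, (q k).1 i = (p k).1 i := fun k => by simp [q]
  have hqj : ∀ k j, j ≠ i → (q k).1 j = (p k0).1 j := fun k j hj => Function.update_of_ne hj ..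
  have hcq : ∀ k, c (q k) = c (p k) := by
    intro k
    by_contra hne
    obtain ⟨k', hk', hinj⟩ := exists_injective_comp_update hp (q := q k) (K := {k})
      (by rw [Finset.card_singleton]; omega) (by simpa using hne)
    rw [Finset.mem_singleton] at hk'
    obtain ⟨j, hjA, hj⟩ := hc _ hinj
    by_cases hji : j = i
    · subst hji
      refine hk' (hj ?_)
      simp only [Function.update_self, Function.update_of_ne (Ne.symm hk')]
      exact hqi k
    by_cases hk0 : k' = k0
    · refine hji (huniq j hjA ?_)
      convert hj using 2 with u
      by_cases hu : u = k'
      · rw [hu, Function.update_self, hqj k j hji, hk0]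
      · rw [Function.update_of_ne hu]
    · refine hk0 (hj ?_)
      simp only [Function.update_self, Function.update_of_ne (Ne.symm hk0)]
      exact hqj k j hji
  refine ⟨q, ?_, i, hiA, fun j hj k k' => (hqj k j hj).trans (hqj k' j hj).symm⟩
  convert hp using 1
  exact funext hcq

/-- Otherwise `q` could replace another point of the line. Direction `i` would then repeat a value,
and any other coordinate is constant on the remaining points, of which there are at least two
because `l ≥ 3`. -/
theorem RainbowInjective.eq_of_line {A : Set ι} {l : ℕ} (hl : 3 ≤ l)
    {c : (∀ j, X j) × F → ℕ} (hc : RainbowInjective A l c) {p : Fin l → (∀ j, X j) × F}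
    (hp : Function.Injective (c ∘ p)) {i : ι}
    (hi : ∀ j, j ≠ i → ∀ k k', (p k).1 j = (p k').1 j) {q : (∀ j, X j) × F} {k : Fin l}
    (hq : q.1 i = (p k).1 i) : c q = c (p k) := by
  by_contra hne
  obtain ⟨k', hk', hinj⟩ := exists_injective_comp_update hp (q := q) (K := {k})
    (by rw [Finset.card_singleton]; omega) (by simpa using hne)
  rw [Finset.mem_singleton] at hk'
  obtain ⟨j, hjA, hj⟩ := hc _ hinj
  by_cases hji : j = i
  · subst hji
    refine hk' (hj ?_)
    simp only [Function.update_self, Function.update_of_ne (Ne.symm hk')]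
    exact hq
  · obtain ⟨u, hu⟩ : ∃ u, u ∉ ({k, k'} : Finset (Fin l)) := by
      by_contra! hcon
      have := Finset.card_le_two (a := k) (b := k')
      rw [Finset.eq_univ_iff_forall.2 hcon, Finset.card_fin] at this
      omega
    simp only [Finset.mem_insert, Finset.mem_singleton, not_or] at hu
    refine hu.1 (hj ?_)
    simp only [Function.update_of_ne hu.2, Function.update_of_ne (Ne.symm hk')]
    exact hi j hji _ _

/-- A monochromatic set that is not constant in any coordinate cannot exist. -/
theorem IsProper.ne_of_fiber {A : Set ι} {l m : ℕ} (hm : 2 ≤ m) {c : (∀ j, X j) × F → ℕ}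
    (hc : (product X F A l m).IsProper c) {q : (∀ j, X j) × F} {w : ∀ j, X j}
    (hw : ∀ j, w j ≠ q.1 j) {G : Finset F} (hG : m - 1 ≤ G.card) (hq : ∀ f ∈ G, (w, f) ≠ q)
    (hcG : ∀ f ∈ G, c (w, f) = c q) : False := by
  obtain ⟨e, hcard, hqe, hpe, he⟩ := exists_finset_insert_fiber (by omega) hG hq
  obtain ⟨f, hf⟩ := hpe hm
  have hce : ∀ x ∈ e, c x = c q := by
    intro x hx
    rcases he x hx with rfl | ⟨f', hf', rfl⟩
    · rfl
    · exact hcG f' hf'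
  obtain ⟨x, hx, y, hy, hxy⟩ := hc.2 e ⟨hcard, fun j => ⟨_, hf, q, hqe, hw j⟩⟩
  exact hxy ((hce x hx).trans (hce y hy).symm)

/-- The proper colorings with at least `l` colors are the coordinates in `A`. -/
theorem IsProper.exists_coordinate [Finite ι] [Finite F] [∀ j, Finite (X j)]
    [∀ j, Nontrivial (X j)] {A : Set ι} {l m : ℕ} (hl : 3 ≤ l) (hm : 2 ≤ m)
    (hF : m - 1 ≤ Nat.card F) {c : (∀ j, X j) × F → ℕ}
    (hc : (product X F A l m).IsProper c) (hlc : l ≤ (Set.range c).ncard) :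
    ∃ i ∈ A, ∀ q q', c q = c q' ↔ q.1 i = q'.1 i := by
  classical
  have hR := hc.rainbowInjective
  obtain ⟨p, hp⟩ : ∃ p : Fin l → (∀ j, X j) × F, Function.Injective (c ∘ p) := by
    have := Fintype.ofFinite (Set.range c)
    obtain ⟨g⟩ := Function.Embedding.nonempty_of_card_le (α := Fin l) (β := Set.range c) (by
      rw [Fintype.card_fin, ← Nat.card_eq_fintype_card]
      exact hlc)
    refine ⟨fun k => (g k).2.choose, fun k k' h => g.injective (Subtype.ext ?_)⟩
    rw [← (g k).2.choose_spec, ← (g k').2.choose_spec]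
    exact h
  obtain ⟨p, hp, i, hiA, hi⟩ := hR.exists_line hl p hp
  have := Fintype.ofFinite F
  have hF' : m - 1 ≤ (Finset.univ : Finset F).card := by
    rwa [Finset.card_univ, ← Nat.card_eq_fintype_card]
  -- If the slice of `q'` is monochromatic, it contains all copies of a point `w` differing from `q`
  -- in every coordinate; with `q` these would make a monochromatic `D`-edge.
  have hother : ∀ q q' : (∀ j, X j) × F, q.1 i ≠ q'.1 i →
      (∀ q'' : (∀ j, X j) × F, q''.1 i = q'.1 i → c q'' = c q') → c q ≠ c q' := by
    intro q q' hne hq' heq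
    choose o ho using fun j => exists_ne (q.1 j)
    have hwi : Function.update o i (q'.1 i) i = q'.1 i := Function.update_self ..
    refine hc.ne_of_fiber hm (q := q) (w := Function.update o i (q'.1 i)) ?_ hF' ?_ ?_
    · intro j
      by_cases hj : j = i
      · subst hj
        rw [hwi]
        exact hne.symm
      · rw [Function.update_of_ne hj]
        exact ho j
    · rintro f - h
      rw [← h] at hne
      exact hne hwi
    · intro f _
      rw [heq]
      exact hq' _ hwi
  have hline : ∀ q q' : (∀ j, X j) × F, q.1 i = q'.1 i → c q = c q' := by
    intro q q' h
    by_cases hex : ∃ k, q.1 i = (p k).1 i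
    · obtain ⟨k, hk⟩ := hex
      rw [hR.eq_of_line hl hp hi hk, hR.eq_of_line hl hp hi (h.symm.trans hk)]
    push Not at hex
    let k0 : Fin l := ⟨0, by omega⟩
    -- For a value of coordinate `i` not on the line, swap in a point of the same line with that
    -- value. By `hother` the new line is still rainbow.
    let q0 : (∀ j, X j) × F := (Function.update (p k0).1 i (q.1 i), (p k0).2)
    have hq0i : q0.1 i = q.1 i := by simp [q0]
    have hp' : Function.Injective (c ∘ Function.update p k0 q0) := by
      refine injective_comp_update hp fun k _ => hother q0 (p k) ?_ fun q'' hq'' =>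
        hR.eq_of_line hl hp hi hq''
      rw [hq0i]
      exact hex k
    have hi' : ∀ j, j ≠ i → ∀ k k',
        (Function.update p k0 q0 k).1 j = (Function.update p k0 q0 k').1 j := by
      have : ∀ j, j ≠ i → ∀ k, (Function.update p k0 q0 k).1 j = (p k0).1 j := by
        intro j hj k
        by_cases hk : k = k0
        · rw [hk, Function.update_self]
          exact Function.update_of_ne hj ..
        · rw [Function.update_of_ne hk]
          exact hi j hj _ _
      exact fun j hj k k' => (this j hj k).trans (this j hj k').symm
    have hk0 : (Function.update p k0 q0 k0).1 i = q.1 i := by rw [Function.update_self, hq0i]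
    rw [hR.eq_of_line hl hp' hi' (k := k0) hk0.symm,
      hR.eq_of_line hl hp' hi' (k := k0) (h.symm.trans hk0.symm)]
  refine ⟨i, hiA, fun q q' => ⟨fun h => ?_, hline q q'⟩⟩
  by_contra hne
  exact hother q q' hne (fun q'' => hline q'' q') h

/-- A proper coloring uses at least as many colors as the smallest coordinate. -/
theorem IsProper.le_ncard_range [Finite ι] [∀ j, Finite (X j)] {A : Set ι} {l m a : ℕ}
    (hm : 2 ≤ m) (hal : a ≤ l) (hX : ∀ j, a ≤ Nat.card (X j))
    {c : (∀ j, X j) × (Fin l × Fin (l * m)) → ℕ}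
    (hc : (product X (Fin l × Fin (l * m)) A l m).IsProper c) : a ≤ (Set.range c).ncard := by
  classical
  by_contra! hlt
  have hδ : ∀ j, ∃ d : Fin a → X j, Function.Injective d := by
    intro j
    have := Fintype.ofFinite (X j)
    obtain ⟨g⟩ := Function.Embedding.nonempty_of_card_le (α := Fin a) (β := X j) (by
      rw [Fintype.card_fin, ← Nat.card_eq_fintype_card]
      exact hX j)
    exact ⟨g, g.injective⟩
  choose δ hδ using hδ
  let T : Finset ℕ := (Set.finite_range c).toFinset
  have hT : T.card < a := by
    rwa [← Set.ncard_eq_toFinset_card _ (Set.finite_range c)]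
  have hTmem : ∀ v, c v ∈ T := fun v => by simp [T]
  -- Diagonal points, pairwise different in every coordinate as `x` varies. The `Fin l` component
  -- keeps them distinct even if `ι` is empty. With fewer than `a ≤ l` colors, each `x` has a color
  -- occurring on at least `m` of its `l * m` copies, and two values of `x` share such a color.
  let z (x : Fin a) (f : Fin (l * m)) : (∀ j, X j) × (Fin l × Fin (l * m)) :=
    (fun j => δ j x, (⟨x, by omega⟩, f))
  have hpop : ∀ x : Fin a, ∃ y ∈ T,
      m ≤ (Finset.univ.filter fun f => c (z x f) = y).card := by
    intro x
    refine Finset.exists_le_card_fiber_of_mul_le_card_of_maps_to (fun f _ => hTmem _)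
      ⟨c (z x ⟨0, ?_⟩), hTmem _⟩ ?_
    · have := x.2
      exact Nat.mul_pos (by omega) (by omega)
    · rw [Finset.card_fin]
      exact Nat.mul_le_mul_right m (by omega)
  choose y hyT hy using hpop
  obtain ⟨x, -, x', -, hne, hxy⟩ := Finset.exists_ne_map_eq_of_card_lt_of_maps_to
    (s := (Finset.univ : Finset (Fin a))) (t := T) (by rwa [Finset.card_fin]) (fun x _ => hyT x)
  obtain ⟨f', hf'⟩ := Finset.card_pos.1 ((by omega : 0 < m).trans_le (hy x'))
  rw [Finset.mem_filter] at hf'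
  let G : Finset (Fin l × Fin (l * m)) :=
    (Finset.univ.filter fun f => c (z x f) = y x).image fun f => (⟨x, by omega⟩, f)
  refine hc.ne_of_fiber hm (q := z x' f') (w := fun j => δ j x) (G := G)
    (fun j h => hne (hδ j h)) ?_ ?_ ?_
  · rw [Finset.card_image_of_injective _ fun f f' h => (Prod.mk.inj h).2]
    exact (Nat.sub_le _ _).trans (hy x)
  · intro f hf h
    simp only [G, Finset.mem_image] at hf
    obtain ⟨f, -, rfl⟩ := hf
    simp only [z, Prod.mk.injEq, Fin.mk.injEq] at h
    exact hne (Fin.ext h.2.1)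
  · intro f hf
    simp only [G, Finset.mem_image, Finset.mem_filter] at hf
    obtain ⟨f, ⟨-, hf⟩, rfl⟩ := hf
    rw [hf'.2, ← hxy]
    exact hf

end Product

/-! ### Isomorphism of colorings and the coordinate colorings. -/

/-- Two colorings with the same color classes differ by a permutation of the colors. -/
theorem exists_perm_of_kernel_eq {V : Type} [Finite V] {c c' : V → ℕ}
    (h : ∀ x y, c x = c y ↔ c' x = c' y) : ∃ σ : Equiv.Perm ℕ, ∀ v, c' v = σ (c v) := by
  obtain ⟨n, ⟨e⟩⟩ := Finite.exists_equiv_fin (Set.range c)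
  have hspec : ∀ k, c (e.symm k).2.choose = e.symm k := fun k => (e.symm k).2.choose_spec
  let x : Fin n ↪ ℕ := ⟨fun k => e.symm k, fun k k' hk => e.symm.injective (Subtype.ext hk)⟩
  let y : Fin n ↪ ℕ := ⟨fun k => c' (e.symm k).2.choose, fun k k' hk => by
    have := (h _ _).2 hk
    rw [hspec, hspec] at this
    exact e.symm.injective (Subtype.ext this)⟩
  -- Only finitely many colors occur, and the permutations of `ℕ` act `n`-transitively.
  obtain ⟨σ, hσ⟩ := (Equiv.Perm.isMultiplyPretransitive ℕ n).exists_smul_eq x y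
  refine ⟨σ, fun v => ?_⟩
  have h1 : c (e.symm (e ⟨c v, v, rfl⟩)).2.choose = c v := by rw [hspec, e.symm_apply_apply]
  have hk : σ (e.symm (e ⟨c v, v, rfl⟩)) = c' (e.symm (e ⟨c v, v, rfl⟩)).2.choose :=
    DFunLike.congr_fun hσ (e ⟨c v, v, rfl⟩)
  rw [← (h _ _).1 h1, ← hk, e.symm_apply_apply]

section Projection

variable {ι F : Type} {n : ι → ℕ}

/-- For `l ≤ n j` the repetition on `C`-edges is built into the product; for `n j < l` it comes from
pigeonhole. -/
theorem isProper_coordinate {l m : ℕ} (j : ι) :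
    (product (fun j => Fin (n j)) F {j | l ≤ n j} l m).IsProper fun q => (q.1 j : ℕ) := by
  constructor
  · rintro e ⟨hcard, he⟩
    by_cases hj : l ≤ n j
    · obtain ⟨x, hx, y, hy, hxy, h⟩ := he j hj
      exact ⟨x, hx, y, hy, hxy, congrArg Fin.val h⟩
    · obtain ⟨x, hx, y, hy, hxy, h⟩ := Finset.exists_ne_map_eq_of_card_lt_of_maps_to
        (s := e) (t := (Finset.univ : Finset (Fin (n j)))) (f := fun q => q.1 j)
        (by rw [Finset.card_fin]; omega) (fun _ _ => Finset.mem_univ _)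
      exact ⟨x, hx, y, hy, hxy, congrArg Fin.val h⟩
  · rintro e ⟨-, he⟩
    obtain ⟨x, hx, y, hy, hxy⟩ := he j
    exact ⟨x, hx, y, hy, fun h => hxy (Fin.ext h)⟩

theorem ncard_range_coordinate [Nonempty F] (hn : ∀ j, 0 < n j) (j : ι) :
    (Set.range fun q : (∀ j, Fin (n j)) × F => (q.1 j : ℕ)).ncard = n j := by
  classical
  have : (Set.range fun q : (∀ j, Fin (n j)) × F => (q.1 j : ℕ)) =
      Set.range (Fin.val : Fin (n j) → ℕ) := by
    ext z
    constructor
    · rintro ⟨q, rfl⟩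
      exact ⟨_, rfl⟩
    · rintro ⟨k, rfl⟩
      exact ⟨(Function.update (fun j => ⟨0, hn j⟩) j k, Classical.arbitrary F), by simp⟩
  rw [this, ncard_range_of_injective Fin.val_injective, Nat.card_fin]

/-- Coordinate `j` can be changed while coordinate `i` is kept. Hence different coordinates of equal
size are non-isomorphic colorings. -/
theorem coordinate_injective [Nonempty F] (hn : ∀ j, 2 ≤ n j) {i j : ι}
    (h : ∀ q q' : (∀ j, Fin (n j)) × F, q.1 i = q'.1 i → q.1 j = q'.1 j) : i = j := by
  classical
  by_contra hne
  let w : ∀ j, Fin (n j) := fun j => ⟨0, by have := hn j; omega⟩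
  let o : F := Classical.arbitrary F
  have := h (w, o) (Function.update w j ⟨1, hn j⟩, o) (by simp [hne])
  simp [w] at this

end Projection

/-! ### Realization with prescribed numbers of colorings. -/

/-- Any finite set that contains all numbers from its lower bound `a ≥ 2` up to `l - 1` is a feasible
set, with prescribed numbers of colorings with at least `l` colors. -/
theorem exists_feasibleSet_eq_and_numColorings {l m a : ℕ} (hl : 3 ≤ l) (hm : 2 ≤ m) (ha : 2 ≤ a)
    (hal : a ≤ l) {S : Finset ℕ} (hS : ∀ s ∈ S, a ≤ s) (hI : ∀ t, a ≤ t → t < l → t ∈ S)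
    {r : ℕ → ℕ} (hr : ∀ s ∈ S, r s ≠ 0) :
    ∃ (V : Type) (_ : Finite V) (H : MixedHypergraph V),
      H.IsNonempty ∧ H.IsUniform l m ∧ l - 1 ≤ Nat.card V ∧ H.feasibleSet = (S : Set ℕ) ∧
        ∀ s ∈ S, l ≤ s → H.numColorings s = r s := by
  let ι : Type := Σ s : S, Fin (r s)
  let n : ι → ℕ := fun j => j.1
  let F : Type := Fin l × Fin (l * m)
  let H := product (fun j : ι => Fin (n j)) F {j | l ≤ n j} l m
  have han : ∀ j, a ≤ n j := fun j => hS _ j.1.2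
  have hn2 : ∀ j, 2 ≤ n j := fun j => ha.trans (han j)
  have hlm : 0 < l * m := Nat.mul_pos (by omega) (by omega)
  have hmlm : m ≤ l * m := Nat.le_mul_of_pos_left m (by omega)
  have hllm : l ≤ l * (l * m) := Nat.le_mul_of_pos_right l hlm
  have hFcard : Nat.card F = l * (l * m) := by
    rw [Nat.card_prod, Nat.card_fin, Nat.card_fin]
  have : Nonempty F := ⟨(⟨0, by omega⟩, ⟨0, hlm⟩)⟩
  have : Finite ι := inferInstanceAs (Finite (Σ s : S, Fin (r s)))
  have : Finite F := inferInstanceAs (Finite (Fin l × Fin (l * m)))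
  have : ∀ j, Nontrivial (Fin (n j)) := fun j => Fin.nontrivial_iff_two_le.2 (hn2 j)
  have : Nonempty (∀ j, Fin (n j)) := ⟨fun j => ⟨0, by have := hn2 j; omega⟩⟩
  have hlow : ∀ c, H.IsProper c → a ≤ (Set.range c).ncard := fun c hc =>
    hc.le_ncard_range hm hal fun j => by rw [Nat.card_fin]; exact han j
  have hcoord : ∀ c, H.IsProper c → l ≤ (Set.range c).ncard →
      ∃ j, (Set.range c).ncard = n j ∧ ∃ σ : Equiv.Perm ℕ, ∀ q, c q = σ (q.1 j : ℕ) := by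
    intro c hc hlc
    obtain ⟨j, -, hj⟩ := hc.exists_coordinate hl hm (by
      rw [hFcard]
      have : l * m ≤ l * (l * m) := Nat.mul_le_mul_left l hmlm
      omega) hlc
    obtain ⟨σ, hσ⟩ := exists_perm_of_kernel_eq (c := fun q : (∀ j, Fin (n j)) × F => (q.1 j : ℕ))
      (c' := c) fun q q' => by rw [hj, Fin.val_inj]
    refine ⟨j, ?_, σ, hσ⟩
    have hcj := ncard_range_coordinate (F := F) (n := n) (fun j => by have := hn2 j; omega) j
    have hrange : Set.range c = σ '' Set.range fun q : (∀ j, Fin (n j)) × F => (q.1 j : ℕ) := by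
      rw [← Set.range_comp]
      exact congrArg Set.range (funext hσ)
    rw [hrange, Set.ncard_image_of_injective _ σ.injective, hcj]
  have hproj : ∀ j, H.IsProperColoring (n j) fun q => (q.1 j : ℕ) := fun j =>
    ⟨isProper_coordinate j, Set.finite_range _,
      ncard_range_coordinate (fun j => by have := hn2 j; omega) j⟩
  refine ⟨(∀ j, Fin (n j)) × F, inferInstance, H, ?_, product_isUniform _ l m, ?_, ?_, ?_⟩
  -- Without edges the constant coloring would be proper, with one color fewer than `a ≥ 2` allows.
  · by_contra hne
    rw [IsNonempty, Set.not_nonempty_iff_eq_empty, Set.union_empty_iff] at hne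
    have := hlow (fun _ => 0) ⟨by simp [hne.1], by simp [hne.2]⟩
    rw [ncard_range_const] at this
    omega
  · have : 0 < Nat.card (∀ j, Fin (n j)) := Nat.card_pos
    rw [Nat.card_prod, hFcard]
    exact (Nat.sub_le _ _).trans (hllm.trans (Nat.le_mul_of_pos_left _ this))
  · ext s
    rw [Finset.mem_coe]
    constructor
    · rw [mem_feasibleSet_iff]
      rintro ⟨c, hc, rfl⟩
      by_cases hlc : l ≤ (Set.range c).ncard
      · obtain ⟨j, hj, -⟩ := hcoord c hc hlc
        rw [hj]
        exact j.1.2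
      · exact hI _ (hlow c hc) (by omega)
    · intro hs
      exact ⟨_, hproj ⟨⟨s, hs⟩, ⟨0, Nat.pos_of_ne_zero (hr s hs)⟩⟩⟩
  · intro s hs hls
    let f : Fin (r s) → Quotient (H.colorIso s) := fun i =>
      Quotient.mk (H.colorIso s) ⟨_, hproj ⟨⟨s, hs⟩, i⟩⟩
    have hf : Function.Bijective f := by
      constructor
      · intro i i' h
        obtain ⟨σ, hσ⟩ := Quotient.exact h
        have : (⟨⟨s, hs⟩, i⟩ : ι) = ⟨⟨s, hs⟩, i'⟩ :=
          coordinate_injective (F := F) hn2 fun q q' hq => Fin.ext (by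
            have h1 := hσ q
            have h2 := hσ q'
            dsimp only at h1 h2
            rw [h1, h2, hq])
        simpa using this
      · intro x
        induction x using Quotient.inductionOn with
        | _ c =>
        obtain ⟨c, hc, hfin, hcs⟩ := c
        obtain ⟨⟨⟨s', hs'⟩, i⟩, hj, σ, hσ⟩ := hcoord c hc (hcs ▸ hls)
        obtain rfl : s' = s := hj.symm.trans hcs
        exact ⟨i, Quotient.sound ⟨σ, hσ⟩⟩
    rw [numColorings, ← Nat.card_congr (Equiv.ofBijective f hf), Nat.card_fin]

end MixedHypergraph

theorem theorem2 (l m : ℕ) (hl : 2 ≤ l) (hm : 2 ≤ m) (S : Finset ℕ) :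
    ((∃ (V : Type) (_ : Finite V) (H : MixedHypergraph V),
        H.IsNonempty ∧ H.IsUniform l m ∧ l - 1 ≤ Nat.card V ∧ H.feasibleSet = (S : Set ℕ)) ↔
      ((∃ x : ℕ, l - 1 ≤ x ∧ S = Finset.Icc 1 x) ∨
       (l = 2 ∧ ∃ a b : ℕ, 1 ≤ a ∧ S = Finset.Icc a b) ∨
       (3 ≤ l ∧ ∀ s ∈ S, l ≤ s) ∨
       (3 ≤ l ∧ ∃ a : ℕ, IsLeast (S : Set ℕ) a ∧ 2 ≤ a ∧ a ≤ l - 1 ∧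
          Finset.Icc a (l - 1) ⊆ S))) ∧
    (((3 ≤ l ∧ ∀ s ∈ S, l ≤ s) ∨
       (3 ≤ l ∧ ∃ a : ℕ, IsLeast (S : Set ℕ) a ∧ 2 ≤ a ∧ a ≤ l - 1 ∧
          Finset.Icc a (l - 1) ⊆ S)) →
      ∀ r : ℕ → ℕ, (∀ s ∈ S, r s ≠ 0) →
        ∃ (V : Type) (_ : Finite V) (H : MixedHypergraph V),
          H.IsNonempty ∧ H.IsUniform l m ∧ l - 1 ≤ Nat.card V ∧ H.feasibleSet = (S : Set ℕ) ∧
          ∀ s ∈ S, l ≤ s → H.numColorings s = r s) := by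
  have key : ((3 ≤ l ∧ ∀ s ∈ S, l ≤ s) ∨
       (3 ≤ l ∧ ∃ a : ℕ, IsLeast (S : Set ℕ) a ∧ 2 ≤ a ∧ a ≤ l - 1 ∧
          Finset.Icc a (l - 1) ⊆ S)) →
      ∀ r : ℕ → ℕ, (∀ s ∈ S, r s ≠ 0) →
        ∃ (V : Type) (_ : Finite V) (H : MixedHypergraph V),
          H.IsNonempty ∧ H.IsUniform l m ∧ l - 1 ≤ Nat.card V ∧ H.feasibleSet = (S : Set ℕ) ∧
          ∀ s ∈ S, l ≤ s → H.numColorings s = r s := by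
    rintro (⟨h3, hS⟩ | ⟨h3, a, ha, h2, hal, hI⟩) r hr
    -- The lower bound is `a = l`, so no number of colors below `l` has to be in `S`.
    · exact MixedHypergraph.exists_feasibleSet_eq_and_numColorings h3 hm hl le_rfl hS
        (fun t h h' => absurd h (by omega)) hr
    · exact MixedHypergraph.exists_feasibleSet_eq_and_numColorings h3 hm h2 (by omega)
        (fun s hs => ha.2 hs) (fun t h h' => hI (Finset.mem_Icc.2 ⟨h, by omega⟩)) hr
  refine ⟨⟨?_, fun h => ?_⟩, key⟩
  · rintro ⟨V, _, H, -, hU, hV, hS⟩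
    exact MixedHypergraph.feasibleSet_cases hl hU hV hS
  · rcases h with ⟨x, hx, rfl⟩ | ⟨rfl, a, b, ha, rfl⟩ | h
    · exact MixedHypergraph.exists_feasibleSet_eq_Icc_one m x hl hx
    · by_cases hab : a ≤ b
      · exact MixedHypergraph.exists_feasibleSet_eq_Icc hm ha hab
      · rw [Finset.Icc_eq_empty hab, Finset.coe_empty]
        exact MixedHypergraph.exists_feasibleSet_eq_empty hm
    · obtain ⟨V, hV, H, h1, h2, h3, h4, -⟩ := key h (fun _ => 1) fun _ _ => one_ne_zero
      exact ⟨V, hV, H, h1, h2, h3, h4⟩
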